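/- Let $k$ be a field and $d\ge 1$. A $d$-graph $H$ is a finite vertex set $V(H)\subset\mathbb Z$ together with a set $E(H)$ of $d$-element subsets of $V(H)$. For $d\ge 2$ and $v\in V(H)$, the $v$-layer of $H$ is the $(d-1)$-graph with vertex set $\{w\in V(H): w>v\}$ whose edges are the sets $E$ of such vertices with $\{v\}\cup E\in E(H)$. Every $1$-graph is cointerval; for $d\ge 2$, a $d$-graph $H$ is cointerval if for every $i\in V(H)$ the $i$-layer of $H$ is cointerval, and for all $i<j$ in $V(H)$ the $j$-layer of $H$ is a subgraph of the $i$-layer of $H$. The edge ideal of $H$ is the ideal $I_H=\langle \prod_{v\in E}x_v : E\in E(H)\rangle$ of the polynomial ring $S=k[x_v : v\in V(H)]$. **Corollary.** If $H$ is a cointerval $d$-graph, then $I_H$ has a $d$-linear resolution. That is, $I_H$ has a minimal $\mathbb Z^{V(H)}$-graded free resolution $$0\to \bigoplus_\alpha S[-\alpha]^{\beta_{\ell,\alpha}}\to\cdots\to\bigoplus_\alpha S[-\alpha]^{\beta_{0,\alpha}}\to I_H\to 0$$ (finite length, finite ranks), and for every such minimal resolution the graded Betti numbers $\beta_{i,j}=\sum_{|\alpha|=j}\beta_{i,\alpha}$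 satisfy $\beta_{i,j}=0$ whenever $j-i\ne d$. -/

import Mathlib

/-- A `d`-graph (`d`-uniform hypergraph): a finite vertex set of integers together with a
collection of `d`-element subsets of it, the edges. -/
structure DGraph (d : ℕ) where
  verts : Finset ℤ
  edges : Finset (Finset ℤ)
  edge_subset : ∀ E ∈ edges, E ⊆ verts
  edge_card : ∀ E ∈ edges, E.card = d

namespace DGraph

/-- The `v`-layer of a `(d+1)`-graph `H`: the `d`-graph on the vertices of `H` larger than `v`
whose edges are the sets `E` of such vertices for which `{v} ∪ E` is an edge of `H`. -/
def layer {d : ℕ} (H : DGraph (d + 1)) (v : ℤ) : DGraph d where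
  verts := H.verts.filter (fun w => v < w)
  edges := (H.verts.filter (fun w => v < w)).powerset.filter (fun E => insert v E ∈ H.edges)
  edge_subset := by
    intro E hE
    exact Finset.mem_powerset.1 (Finset.mem_filter.1 hE).1
  edge_card := by
    intro E hE
    obtain ⟨h1, h2⟩ := Finset.mem_filter.1 hE
    have hv : v ∉ E := fun h =>
      lt_irrefl v (Finset.mem_filter.1 (Finset.mem_powerset.1 h1 h)).2
    have h3 := H.edge_card _ h2
    rw [Finset.card_insert_of_notMem hv] at h3
    omega

/-- `G` is a subgraph of `H`. -/
def IsSubgraph {d : ℕ} (G H : DGraph d) : Prop :=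
  G.verts ⊆ H.verts ∧ G.edges ⊆ H.edges

/-- Cointerval `d`-graphs, by recursion on `d ≥ 1`: every `1`-graph is cointerval, and for `d ≥ 2`
a `d`-graph is cointerval if all its layers are, and for all vertices `i < j` the `j`-layer is a
subgraph of the `i`-layer. (The class contains no `0`-graphs.) -/
def IsCointerval : (d : ℕ) → DGraph d → Prop
  | 0, _ => False
  | 1, _ => True
  | d + 2, H =>
      (∀ i ∈ H.verts, IsCointerval (d + 1) (H.layer i)) ∧
      ∀ i ∈ H.verts, ∀ j ∈ H.verts, i < j → (H.layer j).IsSubgraph (H.layer i)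

/-- The edge ideal of `H` in the polynomial ring over `k` with one variable per vertex of `H`:
it is generated by the monomials `∏ v ∈ E, x_v`, for `E` an edge of `H`. -/
noncomputable def edgeIdeal (k : Type*) [Field k] {d : ℕ} (H : DGraph d) :
    Ideal (MvPolynomial H.verts k) :=
  Ideal.span ((fun E : Finset ℤ =>
    ∏ v ∈ E.subtype (fun w => w ∈ H.verts), (MvPolynomial.X v : MvPolynomial H.verts k)) ''
      (H.edges : Set (Finset ℤ)))

end DGraph

/-- A finely (that is, `ℤ^σ`-) graded free resolution of finite length, by modules of finite rank,
`0 → F_ℓ → ⋯ → F_1 → F_0 → I → 0` of an ideal `I` of `S = k[x_v : v ∈ σ]`. The module `F_i` is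
`S^(rank i)`, with the `b`-th basis vector put in degree `deg i b`, so that
`F_i = ⨁_b S[-deg i b]`; all maps are homogeneous of degree `0`. -/
structure FineFreeResolution {σ k : Type*} [Field k] (I : Ideal (MvPolynomial σ k)) where
  rank : ℕ → ℕ
  deg : (i : ℕ) → Fin (rank i) → σ → ℤ
  /-- The differential `F_{i+1} → F_i`. -/
  diff : (i : ℕ) → (Fin (rank (i + 1)) → MvPolynomial σ k) →ₗ[MvPolynomial σ k]
    (Fin (rank i) → MvPolynomial σ k)
  /-- The augmentation `F_0 → I`. -/
  aug : (Fin (rank 0) → MvPolynomial σ k) →ₗ[MvPolynomial σ k] I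
  diff_homogeneous : ∀ (i : ℕ) (b : Fin (rank (i + 1))) (c : Fin (rank i)),
    ∀ m ∈ (diff i (Pi.single b 1) c).support, ∀ v, (m v : ℤ) + deg i c v = deg (i + 1) b v
  aug_homogeneous : ∀ b : Fin (rank 0),
    ∀ m ∈ (aug (Pi.single b 1) : MvPolynomial σ k).support, ∀ v, (m v : ℤ) = deg 0 b v
  aug_surjective : Function.Surjective aug
  exact_zero : Function.Exact (diff 0) aug
  exact_succ : ∀ i : ℕ, Function.Exact (diff (i + 1)) (diff i)
  finite_length : ∃ l : ℕ, ∀ i, l < i → rank i = 0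

namespace FineFreeResolution

/-- The resolution is minimal: all matrix entries of the differentials `F_{i+1} → F_i` lie in the
maximal ideal generated by the variables, i.e. the image of `F_{i+1}` is in `𝔪 F_i`. -/
def IsMinimal {σ k : Type*} [Field k] {I : Ideal (MvPolynomial σ k)}
    (F : FineFreeResolution I) : Prop :=
  ∀ (i : ℕ) (b : Fin (F.rank (i + 1))) (c : Fin (F.rank i)),
    F.diff i (Pi.single b 1) c ∈ Ideal.span (Set.range (MvPolynomial.X : σ → MvPolynomial σ k))

/-- The number of summands `S[-α]` of `F_i` with `|α| = j`. If the resolution is minimal, this is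
the coarsely graded Betti number `β_{i,j}` of `I`. -/
def coarseRank {σ k : Type*} [Fintype σ] [Field k] {I : Ideal (MvPolynomial σ k)}
    (F : FineFreeResolution I) (i : ℕ) (j : ℤ) : ℕ :=
  (Finset.univ.filter (fun b : Fin (F.rank i) => ∑ v, F.deg i b v = j)).card

end FineFreeResolution

/-- The ideal `I` has a `d`-linear resolution: it has a minimal finely graded free resolution, and
the Betti numbers `β_{i,j}`, read off from any such resolution, vanish whenever `j - i ≠ d`
(so that `F_i` is generated in degree `d + i`). -/
def HasLinearResolution {σ k : Type*} [Fintype σ] [Field k] (d : ℕ)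
    (I : Ideal (MvPolynomial σ k)) : Prop :=
  (∃ F : FineFreeResolution I, F.IsMinimal) ∧
  ∀ F : FineFreeResolution I, F.IsMinimal →
    ∀ (i : ℕ) (j : ℤ), j - i ≠ d → F.coarseRank i j = 0

/-!
The edge ideal of a cointerval `d`-graph is built up one vertex at a time. Let `a` be the smallest
vertex in use, let `J` be the ideal of the `a`-layer and `K` the ideal of the edges avoiding `a`.
The edges containing `a` contribute `x_a J`, so the ideal is `I = x_a J + K`. Every edge avoiding
`a` becomes, after deleting its smallest vertex `j`, an edge of the `j`-layer and hence of the
`a`-layer; thus `K ⊆ J`. As no generator of `K` involves `x_a`, this gives an exact sequence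
`0 → K[-a] → J[-a] ⊕ K → I → 0` with maps `f ↦ (f, -x_a f)` and `(g, f) ↦ x_a g + f`. By induction
`J` is resolved linearly from degree `d - 1` and `K` from degree `d`, so the middle term is linear
from degree `d` and the left one from degree `d + 1`, and `I` is linear from degree `d`
(`FineGrading.HasLinearRes.of_X_mul_add`, `DGraph.hasLinearRes_of_layers`). For `d = 1` the layer of
`a` is either `{∅}`, with `J` the unit ideal, or empty, in which case `I = K`.

Resolutions are handled through their syzygies: `FineGrading.HasLinearRes l n` says recursively that
a graded module is covered by a free module on generators of total degree `n` whose kernel satisfies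
`HasLinearRes (l - 1) (n + 1)`. The horseshoe lemma (`of_extension`) and the mapping cone
(`of_quotient`) then become inductions on `l`, with no chain maps or homotopies to construct.

Splicing the covers gives a finite free resolution, whose differentials have entries of degree one,
so that it is minimal. Conversely, let `q` be any minimal cover of a module with a linear
resolution, and compare it with the linear cover by homogeneous lifts `φ` and `ψ` in both
directions. Modulo the variables `φ ∘ ψ` is the identity, which forces the degrees of the two free
modules to agree; both are then generated in a single total degree, homogeneous maps between them
are given by constant matrices, and `φ` and `ψ` are inverse to each other. Thus `q` is generated in
degree `n` and its kernel is again linear (`of_minimal_cover`). Walking down an arbitrary minimal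
resolution in this way shows that all of its terms have the required degrees.
-/

open MvPolynomial

universe u

noncomputable section

/-! ### Graded modules and graded exact sequences -/

/-- A family of homogeneous pieces `M_α`, `α ∈ ℤ^σ`, of a module over `k[x_v : v ∈ σ]`, such that
multiplication by a monomial shifts degrees by its exponent vector. It is not required that `M` be
the direct sum of its pieces: the arguments only use that maps can be lifted piece by piece, which
`IsGradedSurjective` records explicitly. -/
structure FineGrading (σ : Type) (k : Type u) [Field k] (M : Type u) [AddCommGroup M]
    [Module (MvPolynomial σ k) M] where
  piece : (σ → ℤ) → AddSubgroup M
  monomial_smul_mem : ∀ (m : σ →₀ ℕ) (a : k) {α : σ → ℤ} {x : M}, x ∈ piece α →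
    monomial m a • x ∈ piece (fun v => m v + α v)

namespace FineGrading

variable {σ : Type} {k : Type u} [Field k]
variable {M N A B C : Type u} [AddCommGroup M] [AddCommGroup N] [AddCommGroup A] [AddCommGroup B]
  [AddCommGroup C] [Module (MvPolynomial σ k) M] [Module (MvPolynomial σ k) N]
  [Module (MvPolynomial σ k) A] [Module (MvPolynomial σ k) B] [Module (MvPolynomial σ k) C]

/-- The grading of the polynomial ring by exponent vectors. -/
def poly (σ : Type) (k : Type u) [Field k] : FineGrading σ k (MvPolynomial σ k) where
  piece α :=
    { carrier := {p | ∀ m ∈ p.support, ∀ v, (m v : ℤ) = α v}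
      zero_mem' := by simp
      add_mem' := by
        classical
        intro p q hp hq m hm
        rcases Finset.mem_union.1 (support_add hm) with h | h
        exacts [hp m h, hq m h]
      neg_mem' := by
        intro p hp m hm
        exact hp m (by simpa using hm) }
  monomial_smul_mem := by
    classical
    intro m a α p hp m' hm' v
    have h := support_mul _ _ hm'
    obtain ⟨x, hx, y, hy, rfl⟩ := Finset.mem_add.1 h
    have hx' := Finset.mem_singleton.1 (support_monomial_subset hx)
    subst hx'
    have := hp y hy v
    simp [this]

/-- The grading pulled back along a linear map, for instance to a submodule. -/
def comap (g : FineGrading σ k N) (f : M →ₗ[MvPolynomial σ k] N) : FineGrading σ k M where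
  piece α := (g.piece α).comap f.toAddMonoidHom
  monomial_smul_mem := by
    intro m a α x hx
    have := g.monomial_smul_mem m a (α := α) (x := f x) hx
    simpa using this

theorem mem_comap {g : FineGrading σ k N} {f : M →ₗ[MvPolynomial σ k] N} {α : σ → ℤ} {x : M} :
    x ∈ (g.comap f).piece α ↔ f x ∈ g.piece α := Iff.rfl

/-- The grading of `M[-e]`. -/
def shift (g : FineGrading σ k M) (e : σ → ℤ) : FineGrading σ k M where
  piece α := g.piece (α - e)
  monomial_smul_mem := by
    intro m a α x hx
    have := g.monomial_smul_mem m a hx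
    convert! this using 2
    ext v
    simp
    ring

/-- The grading of a direct sum. -/
def prod (g : FineGrading σ k M) (h : FineGrading σ k N) : FineGrading σ k (M × N) where
  piece α := (g.piece α).prod (h.piece α)
  monomial_smul_mem := fun m a _ _ hx =>
    ⟨g.monomial_smul_mem m a hx.1, h.monomial_smul_mem m a hx.2⟩

section Free

variable {κ : Type}

/-- The grading of the free module `⨁_c S[-deg c]`. -/
def free (k : Type u) [Field k] (deg : κ → σ → ℤ) : FineGrading σ k (κ → MvPolynomial σ k) where
  piece α :=
    { carrier := {x | ∀ c, x c ∈ ((poly σ k).shift (deg c)).piece α}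
      zero_mem' := fun _ => zero_mem _
      add_mem' := fun hx hy c => add_mem (hx c) (hy c)
      neg_mem' := fun hx c => neg_mem (hx c) }
  monomial_smul_mem := fun m a _ _ hx c => ((poly σ k).shift (deg c)).monomial_smul_mem m a (hx c)

variable {deg : κ → σ → ℤ}

theorem mem_free {α : σ → ℤ} {x : κ → MvPolynomial σ k} :
    x ∈ (free k deg).piece α ↔ ∀ c, ∀ m ∈ (x c).support, ∀ v, (m v : ℤ) + deg c v = α v := by
  refine forall_congr' fun c => forall₂_congr fun m _ => forall_congr' fun v => ?_
  simp [eq_sub_iff_add_eq]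

theorem single_mem_free [DecidableEq κ] (c : κ) :
    Pi.single c 1 ∈ (free k deg).piece (deg c) := by
  classical
  rw [mem_free]
  intro b m hm v
  by_cases h : b = c
  · subst h
    have : m = 0 := by
      by_contra hne
      exact hne (by simpa using hm)
    simp [this]
  · simp [Pi.single_eq_of_ne h] at hm

end Free

theorem smul_mem (g : FineGrading σ k M) {α β : σ → ℤ} {p : MvPolynomial σ k} {x : M}
    (hp : p ∈ (poly σ k).piece β) (hx : x ∈ g.piece α) : p • x ∈ g.piece (β + α) := by
  rw [p.as_sum, Finset.sum_smul]
  refine sum_mem fun m hm => ?_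
  have h := g.monomial_smul_mem m (coeff m p) hx
  convert! h using 2
  ext v
  simp [hp m hm v]

theorem map_mem_of_single {κ : Type} [Fintype κ] [DecidableEq κ] {deg : κ → σ → ℤ}
    (g : FineGrading σ k M) (f : (κ → MvPolynomial σ k) →ₗ[MvPolynomial σ k] M)
    (hf : ∀ c, f (Pi.single c 1) ∈ g.piece (deg c)) {α : σ → ℤ} {x : κ → MvPolynomial σ k}
    (hx : x ∈ (free k deg).piece α) : f x ∈ g.piece α := by
  rw [pi_eq_sum_univ' x, map_sum]
  refine sum_mem fun c _ => ?_
  rw [map_smul]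
  have h := g.smul_mem (hx c) (hf c)
  rwa [sub_add_cancel] at h

/-- A degree-preserving surjection that is also surjective on each graded piece. The two
surjectivity conditions are independent, as modules need not be sums of their pieces. -/
structure IsGradedSurjective (gM : FineGrading σ k M) (gN : FineGrading σ k N)
    (f : M →ₗ[MvPolynomial σ k] N) : Prop where
  map_mem : ∀ {α x}, x ∈ gM.piece α → f x ∈ gN.piece α
  surjective : Function.Surjective f
  exists_mem : ∀ {α y}, y ∈ gN.piece α → ∃ x ∈ gM.piece α, f x = y

/-- A short exact sequence that is also exact on each graded piece. -/
structure IsGradedExact (gA : FineGrading σ k A) (gB : FineGrading σ k B) (gC : FineGrading σ k C)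
    (i : A →ₗ[MvPolynomial σ k] B) (p : B →ₗ[MvPolynomial σ k] C) : Prop where
  injective : Function.Injective i
  mem_iff : ∀ {α x}, i x ∈ gB.piece α ↔ x ∈ gA.piece α
  exact : Function.Exact i p
  surj : IsGradedSurjective gB gC p

theorem IsGradedSurjective.exact_ker {gB : FineGrading σ k B} {gC : FineGrading σ k C}
    {p : B →ₗ[MvPolynomial σ k] C} (h : IsGradedSurjective gB gC p) :
    IsGradedExact (gB.comap (LinearMap.ker p).subtype) gB gC (LinearMap.ker p).subtype p where
  injective := Subtype.val_injective
  mem_iff := Iff.rfl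
  exact := LinearMap.exact_subtype_ker_map p
  surj := h

/-- A homogeneous map out of a graded free module lifts through a graded surjection. -/
theorem IsGradedSurjective.exists_lift {κ : Type} [Fintype κ] {deg : κ → σ → ℤ}
    {gB : FineGrading σ k B} {gC : FineGrading σ k C} {p : B →ₗ[MvPolynomial σ k] C}
    (hp : IsGradedSurjective gB gC p) (q : (κ → MvPolynomial σ k) →ₗ[MvPolynomial σ k] C)
    (hq : ∀ {α x}, x ∈ (free k deg).piece α → q x ∈ gC.piece α) :
    ∃ φ : (κ → MvPolynomial σ k) →ₗ[MvPolynomial σ k] B,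
      (∀ {α x}, x ∈ (free k deg).piece α → φ x ∈ gB.piece α) ∧ ∀ x, p (φ x) = q x := by
  classical
  choose b hb hpb using fun c : κ => hp.exists_mem (hq (single_mem_free (k := k) (deg := deg) c))
  refine ⟨Fintype.linearCombination _ b, fun hx => map_mem_of_single gB _ (fun c => ?_) hx,
    fun x => ?_⟩
  · simpa [Fintype.linearCombination_apply_single] using hb c
  · conv_rhs => rw [pi_eq_sum_univ' x]
    simp [Fintype.linearCombination_apply, hpb]

/-- The projection of the polynomial ring onto its piece of degree `α`: extraction of one monomial
if `α` is an exponent vector, and zero otherwise. -/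
theorem exists_poly_projection (α : σ → ℤ) :
    ∃ π : MvPolynomial σ k →+ MvPolynomial σ k, (∀ p, π p ∈ (poly σ k).piece α) ∧
      (∀ p ∈ (poly σ k).piece α, π p = p) ∧
      ∀ β ≠ α, ∀ p ∈ (poly σ k).piece β, π p = 0 := by
  classical
  by_cases h : ∃ m : σ →₀ ℕ, ∀ v, (m v : ℤ) = α v
  · obtain ⟨m, hm⟩ := h
    refine ⟨(monomial m).toAddMonoidHom.comp (lcoeff k m).toAddMonoidHom, fun p => ?_,
      fun p hp => ?_, fun β hβ p hp => ?_⟩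
    · intro m' hm' v
      have := Finset.mem_singleton.1 (support_monomial_subset hm')
      rw [this, hm]
    · change monomial m (coeff m p) = p
      ext m'
      rw [coeff_monomial]
      split_ifs with hmm
      · rw [hmm]
      · by_contra hne
        have := hp m' (mem_support_iff.2 (Ne.symm hne))
        exact hmm (Finsupp.ext fun v => by exact_mod_cast (hm v).trans (this v).symm)
    · change monomial m (coeff m p) = 0
      rw [monomial_eq_zero]
      by_contra hne
      have := hp m (mem_support_iff.2 hne)
      exact hβ (funext fun v => (this v).symm.trans (hm v))
  · refine ⟨0, fun _ => zero_mem _, fun p hp => ?_, fun _ _ _ _ => rfl⟩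
    by_contra hne
    obtain ⟨m, hm⟩ := support_nonempty.2 (Ne.symm hne)
    exact h ⟨m, hp m hm⟩

theorem exists_free_projection {κ : Type} (deg : κ → σ → ℤ) (α : σ → ℤ) :
    ∃ π : (κ → MvPolynomial σ k) →+ (κ → MvPolynomial σ k), (∀ x, π x ∈ (free k deg).piece α) ∧
      (∀ x ∈ (free k deg).piece α, π x = x) ∧
      ∀ β ≠ α, ∀ x ∈ (free k deg).piece β, π x = 0 := by
  choose π h1 h2 h3 using fun c => exists_poly_projection (σ := σ) (k := k) (α - deg c)
  refine ⟨⟨⟨fun x c => π c (x c), by ext; simp⟩, fun x y => by ext; simp⟩, fun x c => h1 c _,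
    fun x hx => funext fun c => h2 c _ (hx c), fun β hβ x hx => funext fun c => h3 c _ ?_ _ (hx c)⟩
  exact fun h => hβ (sub_left_injective h)

/-- If the pieces of the target are split by projections, then a homogeneous map out of a free
module that hits a homogeneous element also hits it from a homogeneous one: the projections commute
with the map, because they do so on multiples of basis vectors by monomials. -/
theorem exists_mem_piece_of_map_mem {κ : Type} [Fintype κ] {deg : κ → σ → ℤ}
    {g : FineGrading σ k M} {f : (κ → MvPolynomial σ k) →ₗ[MvPolynomial σ k] M}
    (hf : ∀ {α x}, x ∈ (free k deg).piece α → f x ∈ g.piece α) {α : σ → ℤ}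
    (hπ : ∃ π : M →+ M, (∀ y ∈ g.piece α, π y = y) ∧ ∀ β ≠ α, ∀ y ∈ g.piece β, π y = 0)
    {x : κ → MvPolynomial σ k} (hx : f x ∈ g.piece α) :
    ∃ x' ∈ (free k deg).piece α, f x' = f x := by
  classical
  obtain ⟨π, h1, h2⟩ := hπ
  obtain ⟨π', h1', h2', h3'⟩ := exists_free_projection (k := k) deg α
  suffices ∀ y, f (π' y) = π (f y) from ⟨π' x, h1' x, (this x).trans (h1 _ hx)⟩
  intro y
  have hy : y = ∑ c, ∑ m ∈ (y c).support, monomial m (coeff m (y c)) • Pi.single c 1 := by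
    conv_lhs => rw [pi_eq_sum_univ' y]
    refine Finset.sum_congr rfl fun c _ => ?_
    rw [← Finset.sum_smul, ← as_sum]
  rw [hy]
  simp only [map_sum]
  refine Finset.sum_congr rfl fun c _ => Finset.sum_congr rfl fun m _ => ?_
  have hm := (free k deg).monomial_smul_mem m (coeff m (y c)) (single_mem_free (k := k) c)
  by_cases hα : (fun v => (m v : ℤ) + deg c v) = α
  · rw [hα] at hm
    rw [h2' _ hm, h1 _ (hf hm)]
  · rw [h3' _ hα _ hm, h2 _ hα _ (hf hm), map_zero]

/-! ### Modules with a linear resolution -/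

/-- `M` has a free resolution with at most `l` terms whose `i`-th term is generated in total degree
`n + i`. For `l = 0` this means `M = 0`; otherwise there is a graded surjection from a free module
of finite rank on generators of total degree `n`, whose kernel has such a resolution with `l - 1`
terms that starts in degree `n + 1`. -/
def HasLinearRes [Fintype σ] : ℕ → ℤ → ∀ {M : Type u} [AddCommGroup M]
    [Module (MvPolynomial σ k) M], FineGrading σ k M → Prop
  | 0, _, M, _, _, _ => Subsingleton M
  | l + 1, n, M, _, _, g => ∃ (r : ℕ) (deg : Fin r → σ → ℤ)
      (f : (Fin r → MvPolynomial σ k) →ₗ[MvPolynomial σ k] M),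
      (∀ b, ∑ v, deg b v = n) ∧ IsGradedSurjective (free k deg) g f ∧
        HasLinearRes l (n + 1) ((free k deg).comap (LinearMap.ker f).subtype)

namespace HasLinearRes

variable [Fintype σ] {l : ℕ} {n : ℤ}

theorem congr (l : ℕ) (n : ℤ) {gM : FineGrading σ k M} {gN : FineGrading σ k N}
    (e : M ≃ₗ[MvPolynomial σ k] N) (he : ∀ {α x}, e x ∈ gN.piece α ↔ x ∈ gM.piece α)
    (h : HasLinearRes l n gM) : HasLinearRes l n gN := by
  induction l generalizing n M N with
  | zero => exact @Equiv.subsingleton _ _ e.symm.toEquiv h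
  | succ l ih =>
    obtain ⟨r, deg, f, hdeg, hf, hl⟩ := h
    refine ⟨r, deg, e.toLinearMap ∘ₗ f, hdeg, ⟨fun hx => he.2 (hf.map_mem hx),
      e.surjective.comp hf.surjective, fun {α y} hy => ?_⟩, ?_⟩
    · obtain ⟨x, hx, hxy⟩ := hf.exists_mem (y := e.symm y) (he.1 (by simpa using hy))
      exact ⟨x, hx, by simp [hxy]⟩
    · exact ih _ (LinearEquiv.ofEq _ _ (LinearEquiv.ker_comp e f).symm) Iff.rfl hl

/-- The kernel of a map does not depend, up to graded isomorphism, on how it is presented. -/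
theorem congr_exact {gA : FineGrading σ k A} {gA' : FineGrading σ k M} {gB : FineGrading σ k B}
    {gC gC' : FineGrading σ k C} {i : A →ₗ[MvPolynomial σ k] B} {i' : M →ₗ[MvPolynomial σ k] B}
    {p p' : B →ₗ[MvPolynomial σ k] C} (h : IsGradedExact gA gB gC i p)
    (h' : IsGradedExact gA' gB gC' i' p') (hp : ∀ x, p x = 0 ↔ p' x = 0)
    (hA : HasLinearRes l n gA) : HasLinearRes l n gA' := by
  have hr : LinearMap.range i = LinearMap.range i' := by
    ext x
    exact (h.exact x).symm.trans ((hp x).trans (h'.exact x))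
  refine congr l n ((LinearEquiv.ofInjective i h.injective).trans ((LinearEquiv.ofEq _ _ hr).trans
    (LinearEquiv.ofInjective i' h'.injective).symm)) (fun {α x} => ?_) hA
  rw [← h'.mem_iff, ← h.mem_iff]
  refine Eq.to_iff (congrArg (· ∈ gB.piece α) ?_)
  exact congrArg Subtype.val (LinearEquiv.apply_symm_apply (LinearEquiv.ofInjective i' h'.injective)
    (LinearEquiv.ofEq _ _ hr (LinearEquiv.ofInjective i h.injective x)))

/-- The cover in the definition of `HasLinearRes` may have any finite index type, and its kernel may
be given by any exact sequence. -/
theorem of_exact {κ : Type} [Fintype κ] {deg : κ → σ → ℤ} (hdeg : ∀ b, ∑ v, deg b v = n)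
    {gA : FineGrading σ k A} {gM : FineGrading σ k M}
    {i : A →ₗ[MvPolynomial σ k] κ → MvPolynomial σ k}
    {f : (κ → MvPolynomial σ k) →ₗ[MvPolynomial σ k] M} (h : IsGradedExact gA (free k deg) gM i f)
    (hA : HasLinearRes l (n + 1) gA) : HasLinearRes (l + 1) n gM := by
  let t := Fintype.equivFin κ
  let e : (Fin (Fintype.card κ) → MvPolynomial σ k) ≃ₗ[MvPolynomial σ k] (κ → MvPolynomial σ k) :=
    LinearEquiv.funCongrLeft _ _ t
  have he : ∀ {α x}, e x ∈ (free k deg).piece α ↔ x ∈ (free k (deg ∘ t.symm)).piece α := by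
    intro α x
    simp only [mem_free, e, LinearEquiv.funCongrLeft_apply, LinearMap.funLeft_apply]
    rw [t.forall_congr_left]
    simp
  have hs : IsGradedSurjective (free k (deg ∘ t.symm)) gM (f ∘ₗ e.toLinearMap) := by
    refine ⟨fun hx => h.surj.map_mem (he.2 hx), h.surj.surjective.comp e.surjective,
      fun {α y} hy => ?_⟩
    obtain ⟨x, hx, hxy⟩ := h.surj.exists_mem hy
    exact ⟨e.symm x, he.1 (by simpa using hx), by simpa using hxy⟩
  have h2 : IsGradedExact gA (free k (deg ∘ t.symm)) gM (e.symm.toLinearMap ∘ₗ i)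
      (f ∘ₗ e.toLinearMap) := by
    refine ⟨e.symm.injective.comp h.injective, ?_, fun x => ?_, hs⟩
    · intro α x
      rw [← h.mem_iff, ← he]
      simp
    · refine (h.exact (e x)).trans ⟨?_, ?_⟩
      · rintro ⟨y, hy⟩
        exact ⟨y, by simp [hy]⟩
      · rintro ⟨y, rfl⟩
        exact ⟨y, by simp⟩
  exact ⟨_, deg ∘ t.symm, f ∘ₗ e.toLinearMap, fun b => hdeg _, hs,
    congr_exact h2 hs.exact_ker (fun _ => Iff.rfl) hA⟩

theorem of_subsingleton (l : ℕ) [Subsingleton M] (g : FineGrading σ k M) : HasLinearRes l n g := by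
  induction l generalizing n M with
  | zero => assumption
  | succ l ih =>
    exact ⟨0, Fin.elim0, 0, fun b => b.elim0, ⟨fun _ => zero_mem _,
      fun y => ⟨0, Subsingleton.elim _ _⟩, fun _ => ⟨0, zero_mem _, Subsingleton.elim _ _⟩⟩, ih _⟩

theorem succ {g : FineGrading σ k M} (h : HasLinearRes l n g) : HasLinearRes (l + 1) n g := by
  induction l generalizing n M with
  | zero =>
    have : Subsingleton M := h
    exact of_subsingleton _ g
  | succ l ih =>
    obtain ⟨r, deg, f, hdeg, hf, hl⟩ := h
    exact ⟨r, deg, f, hdeg, hf, ih hl⟩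

theorem mono {l' : ℕ} (hl : l ≤ l') {g : FineGrading σ k M} (h : HasLinearRes l n g) :
    HasLinearRes l' n g := Nat.le_induction h (fun _ _ => succ) l' hl

theorem shift (e : σ → ℤ) {g : FineGrading σ k M} (h : HasLinearRes l n g) :
    HasLinearRes l (n + ∑ v, e v) (g.shift e) := by
  induction l generalizing n M with
  | zero => exact h
  | succ l ih =>
    obtain ⟨r, deg, f, hdeg, hf, hl⟩ := h
    have hmem : ∀ {α : σ → ℤ} {x : Fin r → MvPolynomial σ k},
        x ∈ (free k (fun b => deg b + e)).piece α ↔ x ∈ (free k deg).piece (α - e) := by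
      intro α x
      simp only [mem_free, Pi.add_apply, Pi.sub_apply, eq_sub_iff_add_eq, add_assoc]
    refine ⟨r, fun b => deg b + e, f, fun b => by simp [Finset.sum_add_distrib, hdeg],
      ⟨fun hx => hf.map_mem (hmem.1 hx), hf.surjective, fun hy => ?_⟩, ?_⟩
    · obtain ⟨x, hx, hxy⟩ := hf.exists_mem hy
      exact ⟨x, hmem.2 hx, hxy⟩
    · have := ih hl
      rw [add_right_comm] at this
      exact congr _ _ (LinearEquiv.refl _ _) (hmem) this

theorem free_module {κ : Type} [Fintype κ] {deg : κ → σ → ℤ} (hdeg : ∀ b, ∑ v, deg b v = n) :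
    HasLinearRes 1 n (free k deg) := by
  have hs : IsGradedSurjective (free k deg) (free k deg) LinearMap.id :=
    ⟨id, Function.surjective_id, fun hy => ⟨_, hy, rfl⟩⟩
  refine of_exact hdeg hs.exact_ker ?_
  have : Subsingleton (LinearMap.ker (LinearMap.id :
      (κ → MvPolynomial σ k) →ₗ[MvPolynomial σ k] _)) := by
    rw [LinearMap.ker_id]; infer_instance
  exact of_subsingleton _ _

/-- The horseshoe lemma: covers of `A` and `C` combine to a cover of `B`, and the three kernels
form a short exact sequence again. -/
theorem of_extension (l : ℕ) {gA : FineGrading σ k A} {gB : FineGrading σ k B}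
    {gC : FineGrading σ k C} {i : A →ₗ[MvPolynomial σ k] B} {p : B →ₗ[MvPolynomial σ k] C}
    (h : IsGradedExact gA gB gC i p) (hA : HasLinearRes l n gA) (hC : HasLinearRes l n gC) :
    HasLinearRes l n gB := by
  induction l generalizing n A B C with
  | zero =>
    have hA : Subsingleton A := hA
    have hC : Subsingleton C := hC
    refine ⟨fun x y => ?_⟩
    have hx : ∀ x : B, x = 0 := fun x => by
      obtain ⟨a, rfl⟩ := (h.exact x).1 (Subsingleton.elim _ _)
      rw [Subsingleton.elim a 0, map_zero]
    rw [hx x, hx y]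
  | succ l ih =>
    obtain ⟨r, deg, f, hdeg, hf, hl⟩ := hA
    obtain ⟨r', deg', f', hdeg', hf', hl'⟩ := hC
    obtain ⟨φ, hφ, hpφ⟩ := h.surj.exists_lift f' hf'.map_mem
    let F : (Fin r ⊕ Fin r' → MvPolynomial σ k) →ₗ[MvPolynomial σ k] B :=
      (i ∘ₗ f) ∘ₗ LinearMap.funLeft _ _ Sum.inl + φ ∘ₗ LinearMap.funLeft _ _ Sum.inr
    have hF : ∀ x, F x = i (f (x ∘ Sum.inl)) + φ (x ∘ Sum.inr) := fun _ => rfl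
    have hFe : ∀ x y, F (Sum.elim x y) = i (f x) + φ y := fun x y => by simp [hF]
    have hpi : ∀ a, p (i a) = 0 := h.exact.apply_apply_eq_zero
    have hpF : ∀ x, p (F x) = f' (x ∘ Sum.inr) := fun x => by simp [hF, hpi, hpφ]
    have helim : ∀ {α x y}, Sum.elim x y ∈ (free k (Sum.elim deg deg')).piece α ↔
        x ∈ (free k deg).piece α ∧ y ∈ (free k deg').piece α := by
      intro α x y
      simp [mem_free]
    have hcomp : ∀ {α x}, x ∈ (free k (Sum.elim deg deg')).piece α ↔
        x ∘ Sum.inl ∈ (free k deg).piece α ∧ x ∘ Sum.inr ∈ (free k deg').piece α := by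
      intro α x
      rw [← helim, Sum.elim_comp_inl_inr]
    have hFs : IsGradedSurjective (free k (Sum.elim deg deg')) gB F := by
      refine ⟨fun hx => ?_, fun b => ?_, fun {α b} hb => ?_⟩
      · exact add_mem (h.mem_iff.2 (hf.map_mem (hcomp.1 hx).1)) (hφ (hcomp.1 hx).2)
      · obtain ⟨y, hy⟩ := hf'.surjective (p b)
        obtain ⟨a, ha⟩ := (h.exact (b - φ y)).1 (by simp [hpφ, hy])
        obtain ⟨x, rfl⟩ := hf.surjective a
        exact ⟨Sum.elim x y, by simp [hFe, ha]⟩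
      · obtain ⟨y, hy', hy⟩ := hf'.exists_mem (h.surj.map_mem hb)
        obtain ⟨a, ha⟩ := (h.exact (b - φ y)).1 (by simp [hpφ, hy])
        obtain ⟨x, hx, rfl⟩ := hf.exists_mem
          (h.mem_iff.1 (ha ▸ sub_mem hb (hφ hy')) : a ∈ gA.piece α)
        exact ⟨Sum.elim x y, helim.2 ⟨hx, hy'⟩, by simp [hFe, ha]⟩
    refine of_exact (by rintro (b | b) <;> simp [hdeg, hdeg']) hFs.exact_ker ?_
    let i' : LinearMap.ker f →ₗ[MvPolynomial σ k] LinearMap.ker F :=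
      LinearMap.codRestrict _ (((LinearEquiv.sumArrowLequivProdArrow _ _ _ _).symm.toLinearMap ∘ₗ
        LinearMap.inl _ _ _) ∘ₗ (LinearMap.ker f).subtype) (by
          intro x
          have : F (Sum.elim x.1 0) = 0 := by simp [hFe]
          exact this)
    let p' : LinearMap.ker F →ₗ[MvPolynomial σ k] LinearMap.ker f' :=
      LinearMap.codRestrict _ (LinearMap.funLeft _ _ Sum.inr ∘ₗ (LinearMap.ker F).subtype) (by
          intro x
          have := hpF x.1
          rw [x.2, map_zero] at this
          exact this.symm)
    have hi' : ∀ x, (i' x).1 = Sum.elim x.1 0 := fun _ => rfl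
    have hp' : ∀ x, (p' x).1 = x.1 ∘ Sum.inr := fun _ => rfl
    refine ih (i := i') (p := p') ⟨fun x y hxy => ?_, ?_, fun x => ?_, ⟨?_, ?_, ?_⟩⟩ hl hl'
    · have := congrArg (fun z => z.1 ∘ Sum.inl) hxy
      exact Subtype.ext (by simpa [hi'] using this)
    · intro α x
      rw [mem_comap, mem_comap, Submodule.subtype_apply, hi', helim]
      exact ⟨fun h => h.1, fun h => ⟨h, zero_mem _⟩⟩
    · constructor
      · intro hx
        have hx2 : x.1 ∘ Sum.inr = 0 := congrArg Subtype.val hx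
        have hx1 : F x.1 = 0 := x.2
        rw [hF, hx2, map_zero, add_zero, map_eq_zero_iff i h.injective] at hx1
        refine ⟨⟨x.1 ∘ Sum.inl, hx1⟩, Subtype.ext ?_⟩
        rw [hi', ← hx2]
        exact Sum.elim_comp_inl_inr _
      · rintro ⟨y, rfl⟩
        exact Subtype.ext (by rw [hp', hi']; rfl)
    · intro α x hx
      exact (hcomp.1 hx).2
    · intro y
      obtain ⟨a, ha⟩ := (h.exact (φ y.1)).1 (by rw [hpφ]; exact y.2)
      obtain ⟨z, rfl⟩ := hf.surjective a
      exact ⟨⟨Sum.elim (-z) y.1, show F _ = 0 by simp [hFe, ha]⟩, Subtype.ext rfl⟩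
    · intro α y hy
      obtain ⟨a, ha⟩ := (h.exact (φ y.1)).1 (by rw [hpφ]; exact y.2)
      obtain ⟨z, hz, rfl⟩ := hf.exists_mem
        (h.mem_iff.1 (ha ▸ hφ hy) : a ∈ gA.piece α)
      exact ⟨⟨Sum.elim (-z) y.1, show F _ = 0 by simp [hFe, ha]⟩,
        helim.2 ⟨neg_mem hz, hy⟩, Subtype.ext rfl⟩

/-- The mapping cone of a linear resolution of `A` into one of `B`, in terms of syzygies: the cover
of `B` also covers `C`, and the kernel of that cover is an extension of `A` by the kernel over
`B`. -/
theorem of_quotient {gA : FineGrading σ k A} {gB : FineGrading σ k B}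
    {gC : FineGrading σ k C} {i : A →ₗ[MvPolynomial σ k] B} {p : B →ₗ[MvPolynomial σ k] C}
    (h : IsGradedExact gA gB gC i p) (hA : HasLinearRes l (n + 1) gA)
    (hB : HasLinearRes (l + 1) n gB) : HasLinearRes (l + 1) n gC := by
  replace hA := congr_exact h h.surj.exact_ker (fun _ => Iff.rfl) hA
  obtain ⟨r, deg, f, hdeg, hf, hl⟩ := hB
  have hs : IsGradedSurjective (free k deg) gC (p ∘ₗ f) := by
    refine ⟨fun hx => h.surj.map_mem (hf.map_mem hx), h.surj.surjective.comp hf.surjective,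
      fun hy => ?_⟩
    obtain ⟨b, hb, rfl⟩ := h.surj.exists_mem hy
    obtain ⟨x, hx, rfl⟩ := hf.exists_mem hb
    exact ⟨x, hx, rfl⟩
  refine of_exact hdeg hs.exact_ker ?_
  have hle : LinearMap.ker f ≤ LinearMap.ker (p ∘ₗ f) := fun x hx => by
    simp [LinearMap.mem_ker.1 hx]
  let q : LinearMap.ker (p ∘ₗ f) →ₗ[MvPolynomial σ k] LinearMap.ker p :=
    f.restrict fun x hx => hx
  refine of_extension l (i := Submodule.inclusion hle) (p := q)
    ⟨Submodule.inclusion_injective hle, Iff.rfl, fun x => ?_, ⟨hf.map_mem, ?_, ?_⟩⟩ hl hA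
  · constructor
    · intro hx
      exact ⟨⟨x.1, congrArg Subtype.val hx⟩, rfl⟩
    · rintro ⟨y, rfl⟩
      exact Subtype.ext y.2
  · intro y
    obtain ⟨x, hx⟩ := hf.surjective y.1
    exact ⟨⟨x, show p (f x) = 0 by rw [hx]; exact y.2⟩, Subtype.ext hx⟩
  · intro α y hy
    obtain ⟨x, hx, hxy⟩ := hf.exists_mem hy
    exact ⟨⟨x, show p (f x) = 0 by rw [hxy]; exact y.2⟩, hx, Subtype.ext hxy⟩

theorem prod {gA : FineGrading σ k A} {gB : FineGrading σ k B} (hA : HasLinearRes l n gA)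
    (hB : HasLinearRes l n gB) : HasLinearRes l n (gA.prod gB) := by
  refine of_extension l (i := LinearMap.inl (MvPolynomial σ k) A B) (p := LinearMap.snd _ A B)
    ⟨LinearMap.inl_injective, ⟨fun h => h.1, fun h => ⟨h, zero_mem _⟩⟩, .inl_snd,
      ⟨fun h => h.2, LinearMap.snd_surjective, fun {α y} hy => ⟨(0, y), ⟨zero_mem _, hy⟩, rfl⟩⟩⟩
    hA hB

end HasLinearRes

end FineGrading

/-! ### Existence and uniqueness of minimal linear resolutions -/

namespace FineGrading

variable {σ : Type} {k : Type u} [Field k] [Fintype σ]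
variable {M : Type u} [AddCommGroup M] [Module (MvPolynomial σ k) M]

/-- A finite graded free resolution of `M` whose `i`-th term is generated in total degree
`n + i`. -/
structure LinearResolution (g : FineGrading σ k M) (n : ℤ) where
  rank : ℕ → ℕ
  deg : (i : ℕ) → Fin (rank i) → σ → ℤ
  diff : (i : ℕ) → (Fin (rank (i + 1)) → MvPolynomial σ k) →ₗ[MvPolynomial σ k]
    (Fin (rank i) → MvPolynomial σ k)
  aug : (Fin (rank 0) → MvPolynomial σ k) →ₗ[MvPolynomial σ k] M
  map_mem : ∀ (i : ℕ) {α x}, x ∈ (free k (deg (i + 1))).piece α →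
    diff i x ∈ (free k (deg i)).piece α
  aug_surj : IsGradedSurjective (free k (deg 0)) g aug
  exact_zero : Function.Exact (diff 0) aug
  exact_succ : ∀ i : ℕ, Function.Exact (diff (i + 1)) (diff i)
  finite_length : ∃ l : ℕ, ∀ i, l < i → rank i = 0
  sum_deg : ∀ i b, ∑ v, deg i b v = n + i

namespace LinearResolution

/-- The resolution of the zero module by zero modules. -/
def ofSubsingleton [Subsingleton M] (g : FineGrading σ k M) (n : ℤ) : LinearResolution g n where
  rank _ := 0
  deg _ b := b.elim0
  diff _ := 0
  aug := 0
  map_mem _ _ _ _ := zero_mem _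
  aug_surj := ⟨fun _ => zero_mem _, fun _ => ⟨0, Subsingleton.elim _ _⟩,
    fun _ => ⟨0, zero_mem _, Subsingleton.elim _ _⟩⟩
  exact_zero _ := ⟨fun _ => ⟨0, Subsingleton.elim _ _⟩, fun _ => rfl⟩
  exact_succ _ _ := ⟨fun _ => ⟨0, Subsingleton.elim _ _⟩, fun _ => rfl⟩
  finite_length := ⟨0, fun _ _ => rfl⟩
  sum_deg _ b := b.elim0

/-- The resolution of `M` obtained by splicing a cover of `M` with a resolution of its kernel. -/
def cons {g : FineGrading σ k M} {n : ℤ} {r : ℕ} {d : Fin r → σ → ℤ}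
    (hd : ∀ b, ∑ v, d b v = n) {f : (Fin r → MvPolynomial σ k) →ₗ[MvPolynomial σ k] M}
    (hf : IsGradedSurjective (free k d) g f)
    (R : LinearResolution ((free k d).comap (LinearMap.ker f).subtype) (n + 1)) :
    LinearResolution g n where
  rank := fun | 0 => r | i + 1 => R.rank i
  deg := fun | 0 => d | i + 1 => R.deg i
  diff := fun | 0 => (LinearMap.ker f).subtype ∘ₗ R.aug | i + 1 => R.diff i
  aug := f
  map_mem := fun | 0 => fun hx => R.aug_surj.map_mem hx | i + 1 => R.map_mem i
  aug_surj := hf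
  exact_zero := by
    intro x
    constructor
    · intro hx
      obtain ⟨y, hy⟩ := R.aug_surj.surjective ⟨x, hx⟩
      exact ⟨y, congrArg Subtype.val hy⟩
    · rintro ⟨y, rfl⟩
      exact (R.aug y).2
  exact_succ := fun
    | 0 => fun x => (Submodule.coe_eq_zero (x := R.aug x)).trans (R.exact_zero x)
    | i + 1 => R.exact_succ i
  finite_length := by
    obtain ⟨l, hl⟩ := R.finite_length
    refine ⟨l + 1, fun i hi => ?_⟩
    cases i with
    | zero => omega
    | succ i => exact hl i (by omega)
  sum_deg := fun
    | 0 => fun b => by simpa using hd b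
    | i + 1 => fun b => by
      have := R.sum_deg i b
      push_cast
      linarith

end LinearResolution

theorem HasLinearRes.nonempty_linearResolution {l : ℕ} {n : ℤ} {g : FineGrading σ k M}
    (h : HasLinearRes l n g) : Nonempty (LinearResolution g n) := by
  induction l generalizing n M with
  | zero =>
    have : Subsingleton M := h
    exact ⟨.ofSubsingleton g n⟩
  | succ l ih =>
    obtain ⟨r, d, f, hd, hf, hl⟩ := h
    obtain ⟨R⟩ := ih hl
    exact ⟨.cons hd hf R⟩

/-- The grading of an ideal by exponent vectors. -/
abbrev ideal (I : Ideal (MvPolynomial σ k)) : FineGrading σ k I :=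
  (poly σ k).comap (Submodule.subtype I)

/-- Between free modules generated in constant total degrees, all monomials in the coordinates of a
homogeneous element have the same total degree. -/
theorem sum_exponents_eq {κ : Type} {deg : κ → σ → ℤ} {n n' : ℤ} (hdeg : ∀ c, ∑ v, deg c v = n)
    {α : σ → ℤ} (hα : ∑ v, α v = n') {x : κ → MvPolynomial σ k}
    (hx : x ∈ (free k deg).piece α) {c : κ} {m : σ →₀ ℕ} (hm : m ∈ (x c).support) :
    ((∑ v, m v : ℕ) : ℤ) = n' - n := by
  have h : ∑ v, ((m v : ℤ) + deg c v) = ∑ v, α v :=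
    Finset.sum_congr rfl fun v _ => mem_free.1 hx c m hm v
  rw [Finset.sum_add_distrib, hdeg, hα] at h
  push_cast
  linarith

/-- The differentials of a linear resolution have entries of degree one, so it is minimal. -/
theorem LinearResolution.exists_isMinimal {I : Ideal (MvPolynomial σ k)} {n : ℤ}
    (R : LinearResolution (ideal I) n) : ∃ F : FineFreeResolution I, F.IsMinimal := by
  refine ⟨⟨R.rank, R.deg, R.diff, R.aug,
    fun i b c => mem_free.1 (R.map_mem i (single_mem_free b)) c,
    fun b => R.aug_surj.map_mem (single_mem_free b), R.aug_surj.surjective, R.exact_zero,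
    R.exact_succ, R.finite_length⟩, fun i b c => ?_⟩
  rw [← Set.image_univ, mem_ideal_span_X_image]
  intro m hm
  by_contra! hm0
  have h := sum_exponents_eq (R.sum_deg i) (R.sum_deg (i + 1) b)
    (R.map_mem i (single_mem_free b)) hm
  rw [Finset.sum_eq_zero fun v _ => hm0 v (Set.mem_univ v)] at h
  push_cast at h
  linarith

/-- A homogeneous lift of the identity along a minimal cover generated in a single total degree is
the identity: it differs from the identity by constants, and these vanish by minimality. -/
theorem eq_of_lift {κ : Type} [Fintype κ] {deg : κ → σ → ℤ} {n : ℤ}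
    (hdeg : ∀ c, ∑ v, deg c v = n) {f : (κ → MvPolynomial σ k) →ₗ[MvPolynomial σ k] M}
    (hf : ∀ x, f x = 0 → ∀ c, constantCoeff (x c) = 0)
    {χ : (κ → MvPolynomial σ k) →ₗ[MvPolynomial σ k] (κ → MvPolynomial σ k)}
    (hχ : ∀ {α x}, x ∈ (free k deg).piece α → χ x ∈ (free k deg).piece α)
    (hfχ : ∀ x, f (χ x) = f x) (x : κ → MvPolynomial σ k) : χ x = x := by
  classical
  suffices χ = LinearMap.id from LinearMap.congr_fun this x
  refine LinearMap.pi_ext' fun c => LinearMap.ext_ring ?_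
  change χ (Pi.single c 1) = Pi.single c 1
  rw [← sub_eq_zero]
  funext b
  ext m
  by_contra hne
  have hm := mem_support_iff.2 hne
  have hmem := sub_mem (hχ (single_mem_free (k := k) (deg := deg) c)) (single_mem_free c)
  have hs := sum_exponents_eq hdeg (hdeg c) hmem hm
  rw [sub_self, Nat.cast_eq_zero, Finset.sum_eq_zero_iff] at hs
  have hm0 : m = 0 := Finsupp.ext fun v => hs v (Finset.mem_univ v)
  subst hm0
  exact hne (hf (χ (Pi.single c 1) - Pi.single c 1) (by simp [hfχ]) b)

/-- A kernel whose generators have larger total degree than the ambient free module lies in the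
maximal ideal times that module. -/
theorem HasLinearRes.constantCoeff_eq_zero {κ : Type} {deg : κ → σ → ℤ} {n : ℤ} {l : ℕ}
    (hdeg : ∀ c, ∑ v, deg c v = n)
    {N : Submodule (MvPolynomial σ k) (κ → MvPolynomial σ k)}
    (h : HasLinearRes l (n + 1) ((free k deg).comap N.subtype)) {x : κ → MvPolynomial σ k}
    (hx : x ∈ N) (c : κ) : constantCoeff (x c) = 0 := by
  cases l with
  | zero =>
    have : Subsingleton N := h
    have : x = 0 := congrArg Subtype.val (Subsingleton.elim (⟨x, hx⟩ : N) 0)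
    simp [this]
  | succ l =>
    obtain ⟨r, d, f, hd, hf, -⟩ := h
    obtain ⟨y, hy⟩ := hf.surjective ⟨x, hx⟩
    have hxy : x = ∑ b, y b • (f (Pi.single b 1)).1 := by
      have := congrArg Subtype.val (congrArg f (pi_eq_sum_univ' y))
      rw [hy] at this
      simpa using this
    rw [hxy, Finset.sum_apply, map_sum]
    refine Finset.sum_eq_zero fun b _ => ?_
    rw [Pi.smul_apply, smul_eq_mul, map_mul]
    by_cases h0 : constantCoeff ((f (Pi.single b 1)).1 c) = 0
    · rw [h0, mul_zero]
    · have hs := sum_exponents_eq hdeg (hd b) (hf.map_mem (single_mem_free b))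
        (mem_support_iff.2 h0)
      simp at hs

/-- Every minimal cover of a module with a linear resolution is generated in the expected degree,
and its kernel has a linear resolution again. -/
theorem HasLinearRes.of_minimal_cover {κ : Type} [Fintype κ] {deg : κ → σ → ℤ} {n : ℤ} {l : ℕ}
    {g : FineGrading σ k M} (h : HasLinearRes l n g)
    {q : (κ → MvPolynomial σ k) →ₗ[MvPolynomial σ k] M}
    (hq : IsGradedSurjective (free k deg) g q)
    (hmin : ∀ x, q x = 0 → ∀ c, constantCoeff (x c) = 0) :
    (∀ c, ∑ v, deg c v = n) ∧
      HasLinearRes (l - 1) (n + 1) ((free k deg).comap (LinearMap.ker q).subtype) := by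
  classical
  cases l with
  | zero =>
    have : Subsingleton M := h
    have hκ : IsEmpty κ := ⟨fun c => by
      simpa using hmin (Pi.single c 1) (Subsingleton.elim _ _) c⟩
    exact ⟨fun c => hκ.elim c, of_subsingleton _ _⟩
  | succ l =>
    obtain ⟨r, d, f, hd, hf, hl⟩ := h
    obtain ⟨ψ, hψ, hfψ⟩ := hf.exists_lift q hq.map_mem
    obtain ⟨φ, hφ, hqφ⟩ := hq.exists_lift f hf.map_mem
    have hdeg : ∀ c, ∑ v, deg c v = n := by
      intro c
      -- Some basis vector `b` occurs with a constant coefficient in `ψ e_c`, so it has the degree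
      -- of `e_c`.
      have h1 : constantCoeff (φ (ψ (Pi.single c 1)) c) = 1 := by
        have := hmin (φ (ψ (Pi.single c 1)) - Pi.single c 1) (by simp [hqφ, hfψ]) c
        simpa [sub_eq_zero] using this
      rw [pi_eq_sum_univ' (ψ (Pi.single c 1)), map_sum, Finset.sum_apply, map_sum] at h1
      obtain ⟨b, -, hb⟩ := Finset.exists_ne_zero_of_sum_ne_zero (h1 ▸ one_ne_zero)
      rw [map_smul, Pi.smul_apply, smul_eq_mul, map_mul] at hb
      have h0 := mem_free.1 (hψ (single_mem_free c)) b 0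
        (mem_support_iff.2 (left_ne_zero_of_mul hb))
      rw [← hd b]
      exact Finset.sum_congr rfl fun v _ => by simpa using (h0 v).symm
    refine ⟨hdeg, ?_⟩
    have hφψ : ∀ x, φ (ψ x) = x := eq_of_lift (χ := φ ∘ₗ ψ) hdeg hmin (fun hx => hφ (hψ hx))
      (fun x => by simp [hqφ, hfψ])
    have hψφ : ∀ x, ψ (φ x) = x := eq_of_lift (χ := ψ ∘ₗ φ) hd
      (fun x hx => hl.constantCoeff_eq_zero hd hx) (fun hx => hψ (hφ hx))
      (fun x => by simp [hqφ, hfψ])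
    refine congr l _ (LinearEquiv.ofLinearMap
      (φ.restrict (p := LinearMap.ker f) (q := LinearMap.ker q) fun x hx => (hqφ x).trans hx)
      (ψ.restrict fun x hx => (hfψ x).trans hx) (LinearMap.ext fun x => Subtype.ext (hφψ x))
      (LinearMap.ext fun x => Subtype.ext (hψφ x))) (fun {α x} => ⟨fun hx => ?_, fun hx => hφ hx⟩)
      hl
    have h := hψ (mem_comap.1 hx)
    change ψ (φ x.1) ∈ _ at h
    rwa [hψφ] at h

theorem HasLinearRes.hasLinearResolution {I : Ideal (MvPolynomial σ k)} {l d : ℕ}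
    (h : HasLinearRes l d (ideal I)) : HasLinearResolution d I := by
  obtain ⟨R⟩ := h.nonempty_linearResolution
  refine ⟨R.exists_isMinimal, fun F hF => ?_⟩
  have hconst : ∀ i x c, constantCoeff (F.diff i x c) = 0 := by
    intro i x c
    rw [pi_eq_sum_univ' x, map_sum, Finset.sum_apply, map_sum]
    refine Finset.sum_eq_zero fun b _ => ?_
    have := hF i b c
    rw [← Set.image_univ, mem_ideal_span_X_image] at this
    rw [map_smul, Pi.smul_apply, smul_eq_mul, map_mul]
    refine mul_eq_zero_of_right _ ?_
    by_contra h0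
    obtain ⟨v, -, hv⟩ := this 0 (mem_support_iff.2 h0)
    exact hv rfl
  have hdiff : ∀ i {α x}, x ∈ (free k (F.deg (i + 1))).piece α →
      F.diff i x ∈ (free k (F.deg i)).piece α := fun i _ _ hx =>
    map_mem_of_single _ _ (fun b => mem_free.2 (F.diff_homogeneous i b)) hx
  have haug : ∀ {α x}, x ∈ (free k (F.deg 0)).piece α → F.aug x ∈ (ideal I).piece α :=
    fun hx => map_mem_of_single (ideal I) F.aug (fun b => F.aug_homogeneous b) hx
  -- The `i`-th term minimally covers the image of the next map down, which has a linear resolution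
  -- from degree `d + i`.
  have hcover : ∀ i, ∃ (M : Type u) (_ : AddCommGroup M) (_ : Module (MvPolynomial σ k) M)
      (g : FineGrading σ k M) (l : ℕ)
      (q : (Fin (F.rank i) → MvPolynomial σ k) →ₗ[MvPolynomial σ k] M),
      HasLinearRes l (d + i) g ∧ IsGradedSurjective (free k (F.deg i)) g q ∧
      ∀ x, q x = 0 ↔ x ∈ LinearMap.range (F.diff i) := by
    intro i
    induction i with
    | zero =>
      refine ⟨I, _, _, ideal I, l, F.aug, by simpa using h, ⟨haug, F.aug_surjective, ?_⟩,
        fun x => F.exact_zero x⟩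
      intro α y hy
      obtain ⟨x, rfl⟩ := F.aug_surjective y
      obtain ⟨π, -, h1, h2⟩ := exists_poly_projection (k := k) α
      obtain ⟨x', hx', hxx⟩ := exists_mem_piece_of_map_mem (f := Submodule.subtype I ∘ₗ F.aug)
        haug ⟨π, h1, h2⟩ (x := x) hy
      exact ⟨x', hx', Subtype.ext hxx⟩
    | succ i ih =>
      obtain ⟨M, _, _, g, l, q, hl, hq, hex⟩ := ih
      have hk := (hl.of_minimal_cover hq fun x hx c => by
        obtain ⟨y, rfl⟩ := (hex x).1 hx
        exact hconst i y c).2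
      refine ⟨LinearMap.ker q, _, _, _, l - 1, (F.diff i).codRestrict _ fun x =>
        (hex _).2 ⟨x, rfl⟩, by push_cast; rwa [← add_assoc], ⟨hdiff i, ?_, ?_⟩, ?_⟩
      · intro y
        obtain ⟨x, hx⟩ := (hex y.1).1 y.2
        exact ⟨x, Subtype.ext hx⟩
      · intro α y hy
        obtain ⟨x, hx⟩ := (hex y.1).1 y.2
        obtain ⟨π, -, h1, h2⟩ := exists_free_projection (k := k) (F.deg i) α
        obtain ⟨x', hx', hxx⟩ := exists_mem_piece_of_map_mem (hdiff i) ⟨π, h1, h2⟩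
          (x := x) (hx ▸ mem_comap.1 hy)
        exact ⟨x', hx', Subtype.ext (hxx.trans hx)⟩
      · intro x
        exact Submodule.coe_eq_zero.symm.trans (F.exact_succ i x)
  intro i j hij
  obtain ⟨M, _, _, g, l, q, hl, hq, hex⟩ := hcover i
  have hdeg := (hl.of_minimal_cover hq fun x hx c => by
    obtain ⟨y, rfl⟩ := (hex x).1 hx
    exact hconst i y c).1
  rw [FineFreeResolution.coarseRank, Finset.card_eq_zero, Finset.filter_eq_empty_iff]
  intro b _ hb
  apply hij
  rw [← hb, hdeg b]
  ring

end FineGrading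

/-! ### Monomial ideals and cointerval hypergraphs -/

namespace FineGrading

variable {σ : Type} {k : Type u} [Field k]

theorem mem_restrictSupportIdeal {T : Set (σ →₀ ℕ)} {hT : IsUpperSet T} {p : MvPolynomial σ k} :
    p ∈ restrictSupportIdeal k T hT ↔ ∀ m ∈ p.support, m ∈ T := Iff.rfl

variable [Fintype σ]

/-- The monomial ideals `I = x_v J + K` with `K ⊆ J` and `(K : x_v) = K` inherit a linear resolution
through the exact sequence `0 → K[-v] → J[-v] ⊕ K → I → 0`. The ideals are given by the exponent
sets of their monomials. -/
theorem HasLinearRes.of_X_mul_add {l : ℕ} {n : ℤ} (v : σ) {TK TJ TI : Set (σ →₀ ℕ)}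
    {hTK : IsUpperSet TK} {hTJ : IsUpperSet TJ} {hTI : IsUpperSet TI}
    (hKJ : TK ⊆ TJ) (hI : ∀ m, m ∈ TI ↔ m ∈ TK ∨ ∃ m' ∈ TJ, m = m' + Finsupp.single v 1)
    (hK : ∀ m, m + Finsupp.single v 1 ∈ TK → m ∈ TK)
    (hJl : HasLinearRes l n (ideal (restrictSupportIdeal k TJ hTJ)))
    (hKl : HasLinearRes l (n + 1) (ideal (restrictSupportIdeal k TK hTK))) :
    HasLinearRes (l + 1) (n + 1) (ideal (restrictSupportIdeal k TI hTI)) := by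
  classical
  set K := restrictSupportIdeal k TK hTK
  set J := restrictSupportIdeal k TJ hTJ
  set I := restrictSupportIdeal k TI hTI
  let e : σ → ℤ := Pi.single v 1
  have he : ∑ w, e w = 1 := by simp [e]
  have hsingle : ∀ (m : σ →₀ ℕ), (fun w => (((m + Finsupp.single v 1 : σ →₀ ℕ) w : ℕ) : ℤ)) =
      (fun w => (m w : ℤ)) + e := by
    intro m
    ext w
    by_cases h : w = v
    · subst h; simp [e]
    · simp [e, h]
  have hle : K ≤ J := fun p hp m hm => hKJ (hp hm)
  have hKI : K ≤ I := fun p hp m hm => (hI m).2 (Or.inl (hp hm))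
  have hXJ : ∀ p ∈ J, X v * p ∈ I := by
    intro p hp
    refine mem_restrictSupportIdeal.2 fun m hm => ?_
    rw [support_X_mul] at hm
    obtain ⟨m', hm', rfl⟩ := Finset.mem_map.1 hm
    exact (hI _).2 (Or.inr ⟨m', hp hm', add_comm _ _⟩)
  have hXpiece : ∀ {α} {p : MvPolynomial σ k}, p ∈ (poly σ k).piece (α - e) →
      X v * p ∈ (poly σ k).piece α := by
    intro α p hp
    have h := (poly σ k).monomial_smul_mem (Finsupp.single v 1) 1 hp
    convert! h using 2
    ext w
    have := congrFun (hsingle 0) w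
    simp at this ⊢
    rw [this]
    ring
  let i : K →ₗ[MvPolynomial σ k] J × K :=
    (Submodule.inclusion hle).prod (-(LinearMap.lsmul _ K (X v)))
  let p : J × K →ₗ[MvPolynomial σ k] I :=
    LinearMap.codRestrict I ((LinearMap.lsmul _ _ (X v) ∘ₗ Submodule.subtype J).coprod
      (Submodule.subtype K)) fun y => add_mem (hXJ _ y.1.2) (hKI y.2.2)
  have hp : ∀ y, (p y : MvPolynomial σ k) = X v * y.1.1 + y.2.1 := fun _ => rfl
  have hi1 : ∀ x, ((i x).1 : MvPolynomial σ k) = x.1 := fun _ => rfl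
  have hi2 : ∀ x, ((i x).2 : MvPolynomial σ k) = -(X v * x.1) := fun _ => rfl
  have hneg : ∀ {α} {x : K}, x.1 ∈ (poly σ k).piece (α - e) → (i x).2 ∈ (ideal K).piece α := by
    intro α x hx
    rw [mem_comap, Submodule.subtype_apply, hi2]
    exact neg_mem (hXpiece hx)
  have hmap : ∀ {α} {y : J × K}, y.1.1 ∈ (poly σ k).piece (α - e) →
      y.2.1 ∈ (poly σ k).piece α → p y ∈ (ideal I).piece α := by
    intro α y h1 h2
    rw [mem_comap, Submodule.subtype_apply, hp]
    exact add_mem (hXpiece h1) h2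
  -- A monomial of `I` is the image of a monomial of `K` or of `J[-v]`; as a homogeneous element
  -- is a single term, this also gives surjectivity on graded pieces.
  have hmono : ∀ m ∈ TI, ∀ a : k,
      ∃ y ∈ (((ideal J).shift e).prod (ideal K)).piece (fun w => (m w : ℤ)),
        (p y : MvPolynomial σ k) = monomial m a := by
    intro m hm a
    have hself : ∀ m : σ →₀ ℕ, monomial m a ∈ (poly σ k).piece (fun w => (m w : ℤ)) := by
      intro m m' hm' w
      rw [Finset.mem_singleton.1 (support_monomial_subset hm')]
    have hT : ∀ {m : σ →₀ ℕ} {T : Set (σ →₀ ℕ)} (hT : IsUpperSet T), m ∈ T →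
        monomial m a ∈ restrictSupportIdeal k T hT := by
      intro m T hT hm m' hm'
      rwa [Finset.mem_singleton.1 (support_monomial_subset hm')]
    rcases (hI m).1 hm with h | ⟨m', h, rfl⟩
    · exact ⟨(0, ⟨_, hT hTK h⟩), ⟨zero_mem _, hself m⟩, by simp [hp]⟩
    · refine ⟨(⟨_, hT hTJ h⟩, 0), ⟨?_, zero_mem _⟩, ?_⟩
      · change monomial m' a ∈ (poly σ k).piece (_ - e)
        rw [hsingle, add_sub_cancel_right]
        exact hself m'
      · simp [hp, X, monomial_mul, add_comm]
  have hsurj : ∀ c : I, ∃ y, p y = c ∧ ∀ α, c ∈ (ideal I).piece α →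
      y ∈ (((ideal J).shift e).prod (ideal K)).piece α := by
    intro c
    choose! y hy hpy using fun m (hm : m ∈ c.1.support) => hmono m (c.2 hm) (coeff m c.1)
    refine ⟨∑ m ∈ c.1.support, y m, Subtype.ext ?_, fun α hα => sum_mem fun m hm => ?_⟩
    · rw [map_sum, AddSubmonoidClass.coe_finsetSum, Finset.sum_congr rfl hpy, ← as_sum]
    · rw [show α = fun w => (m w : ℤ) from funext fun w => (hα m hm w).symm]
      exact hy m hm
  refine of_quotient (gA := (ideal K).shift e) (gB := ((ideal J).shift e).prod (ideal K))
    (i := i) (p := p) ⟨fun x y h => ?_, ?_, fun y => ⟨fun hy => ?_, ?_⟩,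
      fun {α y} hy => ?_, fun c => ?_, fun {α c} hc => ?_⟩ ?_ ?_
  · exact Submodule.inclusion_injective hle (congrArg Prod.fst h)
  · exact fun {α x} => ⟨fun h => h.1, fun h => ⟨h, hneg h⟩⟩
  · have hy' : X v * y.1.1 + y.2.1 = 0 := congrArg Subtype.val hy
    rw [add_eq_zero_iff_neg_eq] at hy'
    have hmem : y.1.1 ∈ K := by
      intro m hm
      refine hK m (y.2.2 (?_ : _ ∈ y.2.1.support))
      rw [← hy', support_neg, support_X_mul]
      exact Finset.mem_map.2 ⟨m, hm, add_comm _ _⟩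
    exact ⟨⟨y.1.1, hmem⟩, Prod.ext rfl (Subtype.ext hy')⟩
  · rintro ⟨x, rfl⟩
    refine Subtype.ext ?_
    rw [hp, hi1, hi2]
    simp
  · exact hmap hy.1 hy.2
  · obtain ⟨y, hy, -⟩ := hsurj c
    exact ⟨y, hy⟩
  · obtain ⟨y, hy, h⟩ := hsurj c
    exact ⟨y, h α hc, hy⟩
  · have := hKl.shift e
    rwa [he] at this
  · have := hJl.shift e
    rw [he] at this
    exact (this.prod hKl).succ

theorem hasLinearRes_ideal_top {I : Ideal (MvPolynomial σ k)} (hI : I = ⊤) :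
    HasLinearRes 1 0 (ideal I) := by
  refine HasLinearRes.congr 1 0 ((LinearEquiv.funUnique Unit (MvPolynomial σ k) _).trans
    (Submodule.topEquiv.symm.trans (LinearEquiv.ofEq _ _ hI.symm))) (fun {α x} => ?_)
    (HasLinearRes.free_module (κ := Unit) (deg := 0) (by simp))
  simp only [mem_free, mem_comap]
  refine ⟨fun h c m hm v => ?_, fun h m hm v => ?_⟩
  · simpa using h m hm v
  · simpa using h () m hm v

end FineGrading

namespace DGraph

open FineGrading

/-- The exponents of the monomials divisible by `∏ v ∈ E, x_v` for some `E` in the family `𝓔`;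
elements of `E` outside `V` are ignored. -/
def coverSet (V : Finset ℤ) (𝓔 : Set (Finset ℤ)) : Set (V →₀ ℕ) :=
  {m | ∃ E ∈ 𝓔, ∀ w : V, (w : ℤ) ∈ E → m w ≠ 0}

theorem isUpperSet_coverSet (V : Finset ℤ) (𝓔 : Set (Finset ℤ)) : IsUpperSet (coverSet V 𝓔) := by
  rintro m m' hmm ⟨E, hE, h⟩
  refine ⟨E, hE, fun w hw => ?_⟩
  have := h w hw
  have := hmm w
  omega

/-- The ideal generated by the squarefree monomials of the members of `𝓔`. The polynomial ring has
the variables of a fixed vertex set `V`, so that the ideals of a hypergraph and of its layers live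
in the same ring. -/
def monomialIdeal (k : Type u) [Field k] (V : Finset ℤ) (𝓔 : Set (Finset ℤ)) :
    Ideal (MvPolynomial V k) :=
  restrictSupportIdeal k (coverSet V 𝓔) (isUpperSet_coverSet V 𝓔)

theorem edgeIdeal_eq (k : Type u) [Field k] {d : ℕ} (H : DGraph d) :
    H.edgeIdeal k = monomialIdeal k H.verts H.edges := by
  classical
  have h : ∀ E : Finset ℤ, ∏ v ∈ E.subtype (fun w => w ∈ H.verts),
      (X v : MvPolynomial H.verts k) =
      monomial (∑ v ∈ E.subtype (fun w => w ∈ H.verts), Finsupp.single v 1) 1 := by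
    intro E
    rw [monomial_sum_one]
    rfl
  ext p
  rw [edgeIdeal, monomialIdeal, mem_restrictSupportIdeal, funext h, ← Set.image_image
    (fun s => monomial s (1 : k)), mem_ideal_span_monomial_image]
  refine forall₂_congr fun m _ => ?_
  rw [Set.exists_mem_image]
  refine exists_congr fun E => and_congr_right fun _ => forall_congr' fun w => ?_
  rw [Finsupp.finsetSum_apply]
  simp only [Finsupp.single_apply, Finset.sum_ite_eq', Finset.mem_subtype]
  split_ifs with hw <;> simp [hw, Nat.one_le_iff_ne_zero]

theorem erase_mem_layer {d : ℕ} {H : DGraph (d + 1)} {E : Finset ℤ} (hE : E ∈ H.edges) {a : ℤ}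
    (ha : a ∈ E) (hmin : ∀ w ∈ E, a ≤ w) : E.erase a ∈ (H.layer a).edges := by
  refine Finset.mem_filter.2 ⟨Finset.mem_powerset.2 fun w hw => ?_, by rwa [Finset.insert_erase ha]⟩
  obtain ⟨hne, hw⟩ := Finset.mem_erase.1 hw
  exact Finset.mem_filter.2 ⟨H.edge_subset E hE hw, lt_of_le_of_ne (hmin w hw) (Ne.symm hne)⟩

/-- A `(d + 1)`-graph whose nonempty layers decrease and have linear resolutions has a linear
resolution itself. The assumptions concern only the nonempty layers, because for `d = 0` the
layer of a vertex that is not an edge is empty while later layers may not be; a vertex with an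
empty layer is the smallest vertex of no edge. -/
theorem hasLinearRes_of_layers {k : Type u} [Field k] {V : Finset ℤ} {d : ℕ} {H : DGraph (d + 1)}
    (hV : H.verts ⊆ V)
    (hlayer : ∀ a ∈ H.verts, (H.layer a).edges.Nonempty →
      (∃ l, HasLinearRes l d (ideal (monomialIdeal k V (H.layer a).edges))) ∧
        ∀ j ∈ H.verts, a < j → (H.layer j).edges ⊆ (H.layer a).edges) :
    ∃ l, HasLinearRes l (d + 1) (ideal (monomialIdeal k V H.edges)) := by
  classical
  -- Vertices are added in decreasing order: `W` runs through the upper sets of vertices.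
  suffices ∀ W : Finset ℤ, W ⊆ H.verts → (∀ a ∈ W, ∀ b ∈ H.verts, a ≤ b → b ∈ W) →
      ∃ l, HasLinearRes l (d + 1) (ideal (monomialIdeal k V {E | E ∈ H.edges ∧ E ⊆ W})) by
    have h := this H.verts subset_rfl fun _ _ b hb _ => hb
    rwa [show {E | E ∈ H.edges ∧ E ⊆ H.verts} = (H.edges : Set (Finset ℤ)) from
      Set.ext fun E => and_iff_left_of_imp (H.edge_subset E)] at h
  intro W
  induction W using Finset.induction_on_min with
  | empty =>
    intro _ _
    have : Subsingleton (monomialIdeal k V {E | E ∈ H.edges ∧ E ⊆ ∅}) := by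
      refine subsingleton_of_forall_eq 0 fun p => Subtype.ext ?_
      by_contra hp
      obtain ⟨m, hm⟩ := support_nonempty.2 hp
      obtain ⟨E, ⟨hE, hE0⟩, -⟩ := p.2 hm
      have := H.edge_card E hE
      rw [Finset.subset_empty.1 hE0] at this
      simp at this
    exact ⟨0, HasLinearRes.of_subsingleton 0 _⟩
  | insert a s ha ih =>
    intro hW hup
    have hs : s ⊆ H.verts := (Finset.subset_insert a s).trans hW
    have hav : a ∈ H.verts := hW (Finset.mem_insert_self a s)
    have has : a ∉ s := fun h => lt_irrefl a (ha a h)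
    have hmin : ∀ w ∈ insert a s, a ≤ w := fun w hw => by
      rcases Finset.mem_insert.1 hw with rfl | h
      exacts [le_rfl, (ha w h).le]
    obtain ⟨l, hl⟩ := ih hs fun x hx b hb hxb =>
      Finset.mem_of_mem_insert_of_ne (hup x (Finset.mem_insert_of_mem hx) b hb hxb)
        ((ha x hx).trans_le hxb).ne'
    rcases (H.layer a).edges.eq_empty_or_nonempty with he | hne
    · refine ⟨l, ?_⟩
      rwa [show {E | E ∈ H.edges ∧ E ⊆ insert a s} = {E | E ∈ H.edges ∧ E ⊆ s} from ?_]
      ext E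
      refine and_congr_right fun hE => ⟨fun h => (Finset.subset_insert_iff_of_notMem ?_).1 h,
        fun h => h.trans (Finset.subset_insert a s)⟩
      intro haE
      have := erase_mem_layer hE haE fun w hw => hmin w (h hw)
      simp [he] at this
    · obtain ⟨⟨l', hl'⟩, hsub⟩ := hlayer a hav hne
      refine ⟨max l l' + 1, HasLinearRes.of_X_mul_add ⟨a, hV hav⟩ ?_ ?_ ?_
        (hl'.mono (le_max_right l l')) (hl.mono (le_max_left l l'))⟩
      · rintro m ⟨E, ⟨hE, hEs⟩, hm⟩
        have hEne : E.Nonempty := Finset.card_pos.1 (by rw [H.edge_card E hE]; omega)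
        have hj := E.min'_mem hEne
        exact ⟨E.erase (E.min' hEne), hsub _ (hs (hEs hj)) (ha _ (hEs hj))
          (erase_mem_layer hE hj fun w hw => E.min'_le w hw),
          fun w hw => hm w (Finset.mem_of_mem_erase hw)⟩
      · intro m
        constructor
        · rintro ⟨E, ⟨hE, hEs⟩, hm⟩
          by_cases haE : a ∈ E
          · right
            have h1 : Finsupp.single (⟨a, hV hav⟩ : V) 1 ≤ m := by
              rw [Finsupp.single_le_iff, Nat.one_le_iff_ne_zero]
              exact hm _ haE
            refine ⟨m - Finsupp.single ⟨a, hV hav⟩ 1, ⟨E.erase a,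
              erase_mem_layer hE haE fun w hw => hmin w (hEs hw), fun w hw => ?_⟩,
              (tsub_add_cancel_of_le h1).symm⟩
            have hwa : (⟨a, hV hav⟩ : V) ≠ w := fun h => by simp [← h] at hw
            rw [Finsupp.tsub_apply, Finsupp.single_eq_of_ne' hwa, tsub_zero]
            exact hm w (Finset.mem_of_mem_erase hw)
          · exact Or.inl ⟨E, ⟨hE, (Finset.subset_insert_iff_of_notMem haE).1 hEs⟩, hm⟩
        · rintro (⟨E, ⟨hE, hEs⟩, hm⟩ | ⟨m, ⟨E, hE, hm⟩, rfl⟩)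
          · exact ⟨E, ⟨hE, hEs.trans (Finset.subset_insert a s)⟩, hm⟩
          · obtain ⟨h1, h2⟩ := Finset.mem_filter.1 (Finset.mem_coe.1 hE)
            refine ⟨insert a E, ⟨h2, Finset.insert_subset (Finset.mem_insert_self a s) ?_⟩,
              fun w hw => ?_⟩
            · intro w hw
              obtain ⟨hwv, haw⟩ := Finset.mem_filter.1 (Finset.mem_powerset.1 h1 hw)
              exact hup a (Finset.mem_insert_self a s) w hwv haw.le
            · rcases Finset.mem_insert.1 hw with h | h
              · simp [show w = ⟨a, hV hav⟩ from Subtype.ext h]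
              · have := hm w h
                rw [Finsupp.add_apply]
                omega
      · rintro m ⟨E, ⟨hE, hEs⟩, hm⟩
        refine ⟨E, ⟨hE, hEs⟩, fun w hw => ?_⟩
        have hwa : (⟨a, hV hav⟩ : V) ≠ w := fun h => has (hEs (by rwa [← h] at hw))
        have := hm w hw
        rwa [Finsupp.add_apply, Finsupp.single_eq_of_ne' hwa, add_zero] at this

/-- The ideal of a cointerval `d`-graph is linear from degree `d`, by induction on `d` along the
layers. For `d = 1` a nonempty layer is `{∅}`, with the unit ideal. -/
theorem IsCointerval.hasLinearRes (k : Type u) [Field k] {V : Finset ℤ} {d : ℕ} {H : DGraph d}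
    (hV : H.verts ⊆ V) (hH : IsCointerval d H) :
    ∃ l, HasLinearRes l d (ideal (monomialIdeal k V H.edges)) := by
  induction d with
  | zero => exact hH.elim
  | succ d ih =>
    rw [Nat.cast_succ]
    refine hasLinearRes_of_layers hV fun a ha hne => ?_
    cases d with
    | zero =>
      have hE : ∀ j, ∀ E ∈ (H.layer j).edges, E = ∅ := fun j E hE =>
        Finset.card_eq_zero.1 ((H.layer j).edge_card E hE)
      have h0 : ∅ ∈ (H.layer a).edges := by
        obtain ⟨E, h⟩ := hne
        rwa [← hE a E h]
      refine ⟨⟨1, hasLinearRes_ideal_top ?_⟩, fun j _ _ E h => by rwa [hE j E h]⟩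
      exact (Ideal.eq_top_iff_one _).2 fun m _ => ⟨∅, h0, by simp⟩
    | succ d =>
      exact ⟨ih ((Finset.filter_subset _ _).trans hV) (hH.1 a ha),
        fun j hj haj => (hH.2 a ha j hj haj).2⟩

end DGraph

end

theorem mainTheorem6 (k : Type*) [Field k] (d : ℕ) (H : DGraph d) (hH : DGraph.IsCointerval d H) :
    HasLinearResolution d (H.edgeIdeal k) := by
  obtain ⟨l, hl⟩ := hH.hasLinearRes k subset_rfl
  rw [H.edgeIdeal_eq k]
  exact hl.hasLinearResolution
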